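/- Let $T\ge 2$ be an integer, and let $\mathcal I$ be the set of unordered pairs $\{j,k\}$ of distinct elements of $\{1,\dots,T\}$, so that $|\mathcal I|=\binom T2$. For $q=(q_i)_{i\in\mathcal I}\in\mathbb R^{\binom T2}$ let $\Sigma(q)$ be the symmetric $T\times T$ matrix with diagonal entries $1$ and $(j,k)$ entry $q_{\{j,k\}}$ for $j\ne k$. For $\gamma\in[0,1)$ put $$\mathcal Q^{(T)}_\gamma=\bigl\{q\in\mathbb R^{\binom T2}:\ \Sigma(q)\succeq(1-\gamma)I\bigr\},\qquad\text{and}\qquad \mathcal Q^{(T)}_1=\bigcup_{\gamma\in[0,1)}\mathcal Q^{(T)}_\gamma ,$$ where $\succeq$ is the order of positive semidefinite matrices. Let $\mathrm{Vol}$ denote $\binom T2$-dimensional Lebesgue measure. Then for every integer $T\ge2$ $$\mathrm{Vol}(\mathcal Q^{(T)}_1)=\frac{\pi^{\frac12\left(\binom T2+1\right)}\,\Gamma(T)\prod_{j=2}^{T-1}\Gamma(j/2)}{2^{T-1}\,\Gamma\!\left(\frac{T+1}2\right)^{T}}$$ (an empty product being $1$), and $$\mathrm{Vol}(\mathcal Q^{(T)}_\gamma)=\gamma^{\binom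 T2}\,\mathrm{Vol}(\mathcal Q^{(T)}_1)\qquad\text{for all }\gamma\in[0,1].$$ In particular $\mathrm{Vol}(\mathcal Q^{(2)}_1)=2$, $\mathrm{Vol}(\mathcal Q^{(3)}_1)=\frac{\pi^2}2$ and $\mathrm{Vol}(\mathcal Q^{(4)}_1)=\frac{32}{27}\pi^2$. Moreover, as $T\to\infty$, with $\log$ the logarithm to base $2$, $$\frac1T\log\mathrm{Vol}(\mathcal Q^{(T)}_1)=\frac{T-1}4\log\frac{2\pi\sqrt e}{T}-\frac{\log e}8+o(1).$$ -/

import Mathlib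

/-- The set `{ {j, k} : j ≠ k }` of unordered pairs of distinct elements of a `T`-element set. -/
abbrev PairIdx (T : ℕ) : Type := {e : Sym2 (Fin T) // ¬ e.IsDiag}

/-- The off-diagonal part: the symmetric matrix with zero diagonal whose `(j, k)` entry, for
`j ≠ k`, is `q_{ {j, k} }`. -/
def offDiagMatrix {T : ℕ} (q : PairIdx T → ℝ) : Matrix (Fin T) (Fin T) ℝ :=
  Matrix.of fun j k =>
    if h : j = k then 0 else q ⟨s(j, k), fun hd => h (Sym2.mk_isDiag_iff.mp hd)⟩

/-- The matrix `Σ(q)`: ones on the diagonal, `q_{ {j, k} }` off the diagonal. -/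
def corrMatrix {T : ℕ} (q : PairIdx T → ℝ) : Matrix (Fin T) (Fin T) ℝ :=
  1 + offDiagMatrix q

/-- For `γ ∈ [0, 1)`, the set of all `q` with `Σ(q) ⪰ (1 - γ) I`. -/
def corrRegionLT (T : ℕ) (γ : ℝ) : Set (PairIdx T → ℝ) :=
  {q | (corrMatrix q - (1 - γ) • (1 : Matrix (Fin T) (Fin T) ℝ)).PosSemidef}

open Classical in
/-- The region `Q_γ` for `γ ∈ [0, 1]`: the set above when `γ < 1`, and for `γ = 1` the union of
all the regions with parameter in `[0, 1)`. -/
noncomputable def corrRegion (T : ℕ) (γ : ℝ) : Set (PairIdx T → ℝ) :=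
  if γ = 1 then ⋃ γ' ∈ Set.Ico (0 : ℝ) 1, corrRegionLT T γ' else corrRegionLT T γ

/-!
Write `ω_n` (`ballVol n`) for the volume of the unit ball of `ℝⁿ`. The region with `γ = 1`
consists of the `q` for which `Σ(q)` is positive definite (`corrRegion_one_eq`), and its volume is
found from the recursion, in the size `T`, of the moments `∫ (det Σ(q)) ^ (m / 2) dq` over this
set (`detMoment`).

A correlation matrix of size `n + 1` is a correlation matrix `S` of size `n` bordered by a vector
`v` and a corner entry `1`. For `S = A Aᵀ` positive definite and `v = A u`, the bordered matrix is
congruent to `diag(1, …, 1, 1 - |u|²)`; so it is positive definite exactly when `|u| < 1`, and its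
determinant is `det S · (1 - |u|²)`. Since `dv = (det S) ^ (1 / 2) du`, integrating out `v` raises
the exponent of `det S` by one half, at the price of the factor `∫ (1 - |u|²) ^ (m / 2) du` over
the unit ball. As `ω_m (1 - |u|²) ^ (m / 2)` is the volume of a slice of the unit ball of
`ℝ^(n + m)`, this factor is `ω_{n+m} / ω_m` (`ballVol_mul_detMoment_succ`). Iterating from `m = 0`
gives the volume `ω_{T-1} ^ T / (ω_0 ⋯ ω_{T-1})` (`volume_posDef_corrMatrix`), which is multiplied
by `(ω_T / ω_{T-1}) ^ T` when `T` grows by one; the Gamma function formula satisfies the same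
recursion (`corrVol_eq`).

For `0 < γ` the region is the dilate by `γ` of the set where `Σ(q)` is positive semidefinite, and
that set exceeds the positive definite one by a null set, since `Σ(t q)` is positive definite for
`0 < t < 1` as soon as `Σ(q)` is positive semidefinite. For `γ = 0` the region lies in all the
others.

For the asymptotics, let `a_n` be the difference between the logarithm of the volume and its
predicted form. The increments of `a` involve `n log (ω_{n+1} / ω_n)`. As
`ω_{n+2} / ω_n = 2π / (n + 2)`, two consecutive increments can be computed together, and their sum
tends to `0` (`tendsto_logVolError_two_step`); log-concavity of `ω` controls what is left and
shows that single increments are bounded. A Cesàro argument then gives `a_n / n → 0`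
(`tendsto_div_of_two_step`).
-/

open MeasureTheory Matrix Filter Topology
open scoped MatrixOrder Pointwise

/-! ### Volumes of Euclidean balls -/

/-- The volume of the unit ball of `n`-dimensional Euclidean space. -/
noncomputable def ballVol (n : ℕ) : ℝ := √Real.pi ^ n / Real.Gamma ((n : ℝ) / 2 + 1)

lemma ballVol_pos (n : ℕ) : 0 < ballVol n := by
  unfold ballVol
  have := Real.Gamma_pos_of_pos (s := (n : ℝ) / 2 + 1) (by positivity)
  have := Real.pi_pos
  positivity

lemma volume_sum_sq_lt {ι : Type*} [Fintype ι] {x : ℝ} (hx : 0 < x) :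
    volume {w : ι → ℝ | ∑ i, w i ^ 2 < x} =
      ENNReal.ofReal (√x ^ Fintype.card ι) * ENNReal.ofReal (ballVol (Fintype.card ι)) := by
  rcases isEmpty_or_nonempty ι with h | h
  · have : {w : ι → ℝ | ∑ i, w i ^ 2 < x} = Set.univ := by
      ext w; simp [hx]
    rw [this]
    simp [ballVol, volume_pi]
  · rw [ENNReal.ofReal_pow (Real.sqrt_nonneg x)]
    unfold ballVol
    rw [← EuclideanSpace.volume_ball ι 0 (√x),
      ← (PiLp.volume_preserving_toLp ι).measure_preimage measurableSet_ball.nullMeasurableSet]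
    congr 1
    ext w
    simp only [Set.mem_ofPred_eq, Set.mem_preimage, Metric.mem_ball, dist_zero_right,
      EuclideanSpace.norm_eq, Real.norm_eq_abs, sq_abs]
    rw [Real.sqrt_lt_sqrt_iff (Finset.sum_nonneg fun i _ => sq_nonneg _)]

lemma volume_sum_sq_lt_of_nonpos {ι : Type*} [Fintype ι] {x : ℝ} (hx : x ≤ 0) :
    volume {w : ι → ℝ | ∑ i, w i ^ 2 < x} = 0 := by
  have : {w : ι → ℝ | ∑ i, w i ^ 2 < x} = ∅ := by
    ext w
    have : 0 ≤ ∑ i, w i ^ 2 := Finset.sum_nonneg fun i _ => sq_nonneg _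
    simp only [Set.mem_ofPred_eq, Set.mem_empty_iff_false, iff_false]
    linarith
  rw [this, measure_empty]

/-- Slicing the unit ball of `ℝ^κ × ℝ^ι` along the `κ` coordinates. -/
lemma lintegral_volume_slice_ball (κ ι : Type*) [Fintype κ] [Fintype ι] :
    ∫⁻ u : κ → ℝ, volume {w : ι → ℝ | ∑ i, w i ^ 2 < 1 - ∑ j, u j ^ 2} =
      ENNReal.ofReal (ballVol (Fintype.card κ + Fintype.card ι)) := by
  have h1 := volume_sum_sq_lt (ι := κ ⊕ ι) one_pos
  simp only [Real.sqrt_one, one_pow, ENNReal.ofReal_one, one_mul, Fintype.card_sum] at h1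
  have hm : MeasurableSet
      {p : (κ → ℝ) × (ι → ℝ) | ∑ j, p.1 j ^ 2 + ∑ i, p.2 i ^ 2 < 1} :=
    measurableSet_lt (by fun_prop) (by fun_prop)
  rw [← h1]
  have h2 := (volume_measurePreserving_sumPiEquivProdPi (fun _ : κ ⊕ ι => ℝ)).measure_preimage
    hm.nullMeasurableSet
  rw [Measure.volume_eq_prod, Measure.prod_apply hm] at h2
  have h3 : (MeasurableEquiv.sumPiEquivProdPi (fun _ : κ ⊕ ι => ℝ)) ⁻¹'
      {p : (κ → ℝ) × (ι → ℝ) | ∑ j, p.1 j ^ 2 + ∑ i, p.2 i ^ 2 < 1} =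
      {w : κ ⊕ ι → ℝ | ∑ i, w i ^ 2 < 1} := by
    ext w
    simp [MeasurableEquiv.coe_sumPiEquivProdPi]
  rw [← h3, h2]
  refine lintegral_congr fun u => ?_
  congr 1
  ext w
  simp only [Set.mem_ofPred_eq, Set.mem_preimage]
  constructor <;> intro h <;> linarith

/-! ### Bordered matrices and powers of the determinant -/

open Classical in
/-- The weight `(det M) ^ (m / 2)` on the cone of positive definite matrices, extended by zero. -/
noncomputable def detWeight {ι : Type*} [Fintype ι] [DecidableEq ι] (m : ℕ) (M : Matrix ι ι ℝ) :
    ENNReal :=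
  if M.PosDef then ENNReal.ofReal (√M.det ^ m) else 0

lemma detWeight_submatrix_equiv {ι κ : Type*} [Fintype ι] [Fintype κ] [DecidableEq ι]
    [DecidableEq κ] (m : ℕ) (M : Matrix ι ι ℝ) (e : κ ≃ ι) :
    detWeight m (M.submatrix e e) = detWeight m M := by
  have h : (M.submatrix e e).PosDef ↔ M.PosDef := by
    refine ⟨fun h => ?_, fun h => h.submatrix e.injective⟩
    simpa using h.submatrix e.symm.injective
  by_cases hM : M.PosDef
  · rw [detWeight, detWeight, if_pos hM, if_pos (h.2 hM), Matrix.det_submatrix_equiv_self e M]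
  · rw [detWeight, detWeight, if_neg hM, if_neg (mt h.1 hM)]

/-- Positive definiteness is positive semidefiniteness, a closed condition, together with a
nonvanishing determinant. -/
lemma measurableSet_posDef (ι : Type*) [Fintype ι] :
    MeasurableSet {M : ι → ι → ℝ | (Matrix.of M).PosDef} := by
  classical
  have h : {M : ι → ι → ℝ | (Matrix.of M).PosDef} =
      ({M | (Matrix.of M).IsHermitian} ∩
        ⋂ x : ι → ℝ, {M | 0 ≤ star x ⬝ᵥ (Matrix.of M *ᵥ x)}) ∩ {M | (Matrix.of M).det ≠ 0} := by
    ext M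
    simp only [Set.mem_ofPred_eq, Set.mem_inter_iff, Set.mem_iInter]
    rw [← posSemidef_iff_dotProduct_mulVec]
    exact ⟨fun h => ⟨h.posSemidef, h.det_pos.ne'⟩, fun h => h.1.posDef_iff_det_ne_zero.2 h.2⟩
  rw [h]
  refine MeasurableSet.inter (IsClosed.inter ?_ (isClosed_iInter fun x => ?_)).measurableSet
    (IsOpen.measurableSet ?_)
  · unfold Matrix.IsHermitian
    exact isClosed_eq (by fun_prop) (by fun_prop)
  · exact isClosed_le (by fun_prop) (by fun_prop)
  · exact isOpen_ne_fun (by fun_prop) (by fun_prop)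

lemma measurable_detWeight {α : Type*} [MeasurableSpace α] {ι : Type*} [Fintype ι]
    [DecidableEq ι] (m : ℕ) {f : α → Matrix ι ι ℝ} (hf : ∀ i j, Measurable fun a => f a i j) :
    Measurable fun a => detWeight m (f a) := by
  have hf' : Measurable fun a => (fun i j => f a i j : ι → ι → ℝ) := by
    refine measurable_pi_lambda _ fun i => measurable_pi_lambda _ fun j => hf i j
  have hs : MeasurableSet {a | (f a).PosDef} := hf' (measurableSet_posDef ι)
  refine Measurable.ite hs (Measurable.ennreal_ofReal (Measurable.pow_const ?_ m)) measurable_const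
  refine Measurable.sqrt ?_
  simp only [Matrix.det_apply]
  fun_prop

lemma posDef_one_diag_iff {ι : Type*} [Fintype ι] [DecidableEq ι] (c : ℝ) :
    (fromBlocks (1 : Matrix ι ι ℝ) 0 0 (diagonal fun _ : Fin 1 => c)).PosDef ↔ 0 < c := by
  rw [← diagonal_one, fromBlocks_diagonal, posDef_diagonal_iff]
  simp

/-- Bordering `A Aᵀ` by the vector `A u`: the bordered matrix is `L D Lᵀ` with
`L = [A 0; uᵀ 1]` and `D = diag(1, …, 1, 1 - |u|²)`. -/
lemma detWeight_bordered {ι : Type*} [Fintype ι] [DecidableEq ι] (m : ℕ) (A : Matrix ι ι ℝ)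
    (hA : A.det ≠ 0) (u : ι → ℝ) :
    ENNReal.ofReal (ballVol m) *
      detWeight m (fromBlocks (A * Aᵀ) (replicateCol (Fin 1) (A *ᵥ u))
        (replicateRow (Fin 1) (A *ᵥ u)) 1) =
      ENNReal.ofReal (|A.det| ^ m) *
        volume {w : Fin m → ℝ | ∑ i, w i ^ 2 < 1 - ∑ j, u j ^ 2} := by
  classical
  set L : Matrix (ι ⊕ Fin 1) (ι ⊕ Fin 1) ℝ := fromBlocks A 0 (replicateRow (Fin 1) u) 1 with hL
  set c : ℝ := 1 - ∑ j, u j ^ 2 with hc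
  set D : Matrix (ι ⊕ Fin 1) (ι ⊕ Fin 1) ℝ :=
    fromBlocks 1 0 0 (diagonal fun _ : Fin 1 => c) with hD
  have hfac : fromBlocks (A * Aᵀ) (replicateCol (Fin 1) (A *ᵥ u))
        (replicateRow (Fin 1) (A *ᵥ u)) 1 = L * D * star L := by
    rw [hL, hD, star_eq_conjTranspose, fromBlocks_conjTranspose, fromBlocks_multiply,
      fromBlocks_multiply]
    congr 1
    · simp
    · ext i j; simp [Matrix.mul_apply, mulVec, dotProduct]
    · ext i j; simp [Matrix.mul_apply, mulVec, dotProduct, mul_comm]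
    · ext i j
      have : i = j := Subsingleton.elim _ _
      subst this
      simp [Matrix.mul_apply, hc, sq]
  have hLdet : L.det = A.det := by simp [hL]
  have hLu : IsUnit L := by
    rw [Matrix.isUnit_iff_isUnit_det, hLdet]; exact hA.isUnit
  have hpd : (L * D * star L).PosDef ↔ 0 < c := by
    rw [hLu.posDef_star_right_conjugate_iff, posDef_one_diag_iff]
  have hdet : (L * D * star L).det = A.det ^ 2 * c := by
    rw [det_mul, det_mul, star_eq_conjTranspose, det_conjTranspose, hLdet]
    simp [hD]; ring
  rw [hfac]
  unfold detWeight
  by_cases h : 0 < c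
  · rw [if_pos (hpd.2 h), volume_sum_sq_lt h]
    have : √(L * D * star L).det = |A.det| * √c := by
      rw [hdet, Real.sqrt_mul (sq_nonneg _), Real.sqrt_sq_eq_abs]
    rw [this, mul_pow, ENNReal.ofReal_mul (by positivity), Fintype.card_fin]
    ring
  · rw [if_neg (mt hpd.1 h), volume_sum_sq_lt_of_nonpos (not_lt.1 h)]
    simp

/-- Linear change of variables by an invertible matrix. -/
lemma lintegral_eq_det_mul_lintegral_mulVec {ι : Type*} [Fintype ι] [DecidableEq ι]
    (A : Matrix ι ι ℝ) (hA : A.det ≠ 0) {f : (ι → ℝ) → ENNReal} (hf : Measurable f) :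
    ∫⁻ v, f v = ENNReal.ofReal |A.det| * ∫⁻ u, f (A *ᵥ u) := by
  have hm : Measurable (toLin' A) := (toLin' A).continuous_of_finiteDimensional.measurable
  have h := lintegral_map hf hm (μ := volume)
  rw [Real.map_matrix_volume_pi_eq_smul_volume_pi hA, lintegral_smul_measure] at h
  simp only [toLin'_apply] at h
  rw [← h, smul_eq_mul, ← mul_assoc, ← ENNReal.ofReal_mul (abs_nonneg _), ← abs_mul,
    mul_inv_cancel₀ hA]
  simp

/-- Integrating the weight over the border `v` of `[S v; vᵀ 1]` shifts the exponent by one half.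
For positive definite `S = A Aᵀ`, substitute `v = A u`. -/
lemma lintegral_detWeight_bordered (n m : ℕ) (S : Matrix (Fin n) (Fin n) ℝ) :
    ENNReal.ofReal (ballVol m) *
      ∫⁻ v : Fin n → ℝ, detWeight m (fromBlocks S (replicateCol (Fin 1) v)
        (replicateRow (Fin 1) v) 1) =
      ENNReal.ofReal (ballVol (n + m)) * detWeight (m + 1) S := by
  have hmeas : Measurable fun v : Fin n → ℝ => detWeight m (fromBlocks S
      (replicateCol (Fin 1) v) (replicateRow (Fin 1) v) 1) := by
    refine measurable_detWeight m ?_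
    rintro (i | i) (j | j) <;> simp <;> fun_prop
  by_cases hS : S.PosDef
  · obtain ⟨B, hB, hSB⟩ := CStarAlgebra.isStrictlyPositive_iff_eq_star_mul_self.1
      hS.isStrictlyPositive
    set A := Bᵀ with hA
    have hSA : S = A * Aᵀ := by
      rw [hSB, hA, transpose_transpose, star_eq_conjTranspose,
        conjTranspose_eq_transpose_of_trivial]
    have hAdet : A.det ≠ 0 := by
      rw [hA, det_transpose]
      exact ((Matrix.isUnit_iff_isUnit_det B).1 hB).ne_zero
    rw [lintegral_eq_det_mul_lintegral_mulVec A hAdet hmeas, mul_left_comm,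
      ← lintegral_const_mul' _ _ ENNReal.ofReal_ne_top]
    simp only [hSA, detWeight_bordered m A hAdet]
    rw [lintegral_const_mul' _ _ ENNReal.ofReal_ne_top, lintegral_volume_slice_ball, ← mul_assoc,
      ← ENNReal.ofReal_mul (abs_nonneg _), mul_comm]
    have hdet : √(A * Aᵀ).det = |A.det| := by
      rw [det_mul, det_transpose A, Real.sqrt_mul_self_eq_abs]
    rw [← hSA] at hdet ⊢
    rw [detWeight, if_pos hS, hdet, pow_succ', Fintype.card_fin, Fintype.card_fin]
  · have h0 : ∀ v : Fin n → ℝ, detWeight m (fromBlocks S (replicateCol (Fin 1) v)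
        (replicateRow (Fin 1) v) 1) = 0 := by
      intro v
      refine if_neg fun h => hS ?_
      exact h.submatrix (e := Sum.inl) Sum.inl_injective
    simp only [h0, lintegral_zero, mul_zero]
    rw [detWeight, if_neg hS, mul_zero]

/-! ### Adding a row and a column to a correlation matrix -/

/-- Pairs from `{0, …, n}` are pairs from `{0, …, n - 1}` together with the pairs `{j, n}`. -/
noncomputable def pairIdxSuccEquiv (n : ℕ) : PairIdx n ⊕ Fin n ≃ PairIdx (n + 1) :=
  Equiv.ofBijective
    (Sum.elim
      (fun e => ⟨e.1.map Fin.castSucc,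
        fun h => e.2 ((Sym2.isDiag_map (Fin.castSucc_injective n)).1 h)⟩)
      (fun j => ⟨s(j.castSucc, Fin.last n),
        fun h => (Fin.castSucc_lt_last j).ne (Sym2.mk_isDiag_iff.1 h)⟩))
    (by
      constructor
      · rintro (⟨e, he⟩ | i) (⟨f, hf⟩ | j) h
        · have := Sym2.map.injective (Fin.castSucc_injective n) (Subtype.ext_iff.1 h)
          exact congrArg Sum.inl (Subtype.ext this)
        · have h1 := (Subtype.ext_iff.1 h)
          have : Fin.last n ∈ e.map Fin.castSucc := by
            simp only [Sum.elim_inl, Sum.elim_inr] at h1; rw [h1]; simp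
          obtain ⟨a, -, ha⟩ := Sym2.mem_map.1 this
          exact absurd ha (Fin.castSucc_lt_last a).ne
        · have h1 := (Subtype.ext_iff.1 h)
          have : Fin.last n ∈ f.map Fin.castSucc := by
            simp only [Sum.elim_inl, Sum.elim_inr] at h1; rw [← h1]; simp
          obtain ⟨a, -, ha⟩ := Sym2.mem_map.1 this
          exact absurd ha (Fin.castSucc_lt_last a).ne
        · have h1 := (Subtype.ext_iff.1 h)
          simp only [Sum.elim_inr] at h1
          rw [Sym2.congr_left] at h1
          rw [Fin.castSucc_injective n h1]
      · rintro ⟨e, he⟩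
        induction e with | _ a b
        induction a using Fin.lastCases with
        | last =>
          induction b using Fin.lastCases with
          | last => exact absurd rfl he
          | cast b => exact ⟨Sum.inr b, Subtype.ext Sym2.eq_swap⟩
        | cast a =>
          induction b using Fin.lastCases with
          | last => exact ⟨Sum.inr a, rfl⟩
          | cast b =>
            refine ⟨Sum.inl ⟨s(a, b), fun h => he ?_⟩, rfl⟩
            rw [Sym2.mk_isDiag_iff] at h ⊢
            rw [h])

lemma corrMatrix_apply_ne {T : ℕ} (q : PairIdx T → ℝ) {j k : Fin T} (h : j ≠ k) :
    corrMatrix q j k = q ⟨s(j, k), fun hd => h (Sym2.mk_isDiag_iff.mp hd)⟩ := by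
  simp [corrMatrix, offDiagMatrix, h]

lemma corrMatrix_apply_self {T : ℕ} (q : PairIdx T → ℝ) (j : Fin T) : corrMatrix q j j = 1 := by
  simp [corrMatrix, offDiagMatrix]

/-- Splitting off the last row and column of `Σ(q)`. -/
lemma corrMatrix_succ {n : ℕ} (q : PairIdx (n + 1) → ℝ) :
    (corrMatrix q).submatrix finSumFinEquiv finSumFinEquiv =
      fromBlocks (corrMatrix fun e => q (pairIdxSuccEquiv n (Sum.inl e)))
        (replicateCol (Fin 1) fun j => q (pairIdxSuccEquiv n (Sum.inr j)))
        (replicateRow (Fin 1) fun j => q (pairIdxSuccEquiv n (Sum.inr j))) 1 := by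
  have hl : ∀ i : Fin 1, (finSumFinEquiv (Sum.inr i) : Fin (n + 1)) = Fin.last n := by
    intro i; ext; simp
  have hc : ∀ i : Fin n, (finSumFinEquiv (Sum.inl i) : Fin (n + 1)) = i.castSucc := by
    intro i; ext; simp
  ext (i | i) (j | j)
  · rw [submatrix_apply, hc, hc, fromBlocks_apply₁₁]
    by_cases h : i = j
    · subst h; rw [corrMatrix_apply_self, corrMatrix_apply_self]
    · rw [corrMatrix_apply_ne _ h, corrMatrix_apply_ne _ (fun e => h (Fin.castSucc_injective n e))]
      rfl
  · rw [submatrix_apply, hc, hl, fromBlocks_apply₁₂,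
      corrMatrix_apply_ne _ (Fin.castSucc_lt_last i).ne]
    rfl
  · rw [submatrix_apply, hc, hl, fromBlocks_apply₂₁,
      corrMatrix_apply_ne _ (Fin.castSucc_lt_last j).ne', replicateRow_apply]
    congr 1
    exact Subtype.ext Sym2.eq_swap
  · rw [submatrix_apply, hl, hl, fromBlocks_apply₂₂, corrMatrix_apply_self,
      Subsingleton.elim i j, one_apply_eq]

lemma measurable_corrMatrix_apply {T : ℕ} (j k : Fin T) :
    Measurable fun q : PairIdx T → ℝ => corrMatrix q j k := by
  by_cases h : j = k
  · subst h; simp only [corrMatrix_apply_self]; exact measurable_const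
  · simp only [corrMatrix_apply_ne _ h]; fun_prop

/-- The integral of `(det Σ(q)) ^ (m / 2)` over the positive definite `Σ(q)`. -/
noncomputable def detMoment (T m : ℕ) : ENNReal :=
  ∫⁻ q : PairIdx T → ℝ, detWeight m (corrMatrix q)

/-- The recursion behind the volume formula: Fubini with respect to the last row of `Σ(q)`. -/
lemma ballVol_mul_detMoment_succ (n m : ℕ) :
    ENNReal.ofReal (ballVol m) * detMoment (n + 1) m =
      ENNReal.ofReal (ballVol (n + m)) * detMoment n (m + 1) := by
  let g : (PairIdx n → ℝ) × (Fin n → ℝ) → ENNReal := fun p =>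
    detWeight m (fromBlocks (corrMatrix p.1) (replicateCol (Fin 1) p.2)
      (replicateRow (Fin 1) p.2) 1)
  have hg : Measurable g := by
    refine measurable_detWeight m ?_
    rintro (i | i) (j | j)
    · exact (measurable_corrMatrix_apply i j).comp measurable_fst
    all_goals simp; try fun_prop
  have h1 : detMoment (n + 1) m = ∫⁻ p, g p := by
    -- Reindexing the coordinates of `q` as (pairs of old indices, last row) preserves volume.
    have e1 := (volume_measurePreserving_piCongrLeft (fun _ : PairIdx (n + 1) => ℝ)
      (pairIdxSuccEquiv n)).symm
    have e2 := volume_measurePreserving_sumPiEquivProdPi (fun _ : PairIdx n ⊕ Fin n => ℝ)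
    rw [← (e2.comp e1).lintegral_comp hg]
    refine lintegral_congr fun q => ?_
    rw [← detWeight_submatrix_equiv m (corrMatrix q) finSumFinEquiv, corrMatrix_succ]
    rfl
  rw [h1, Measure.volume_eq_prod, lintegral_prod _ hg.aemeasurable,
    ← lintegral_const_mul' _ _ ENNReal.ofReal_ne_top]
  simp only [g, lintegral_detWeight_bordered]
  rw [lintegral_const_mul' _ _ ENNReal.ofReal_ne_top]
  rfl

lemma detMoment_zero (m : ℕ) : detMoment 0 m = 1 := by
  have hpd : ∀ q : PairIdx 0 → ℝ, (corrMatrix q).PosDef := fun q => by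
    rw [Subsingleton.elim (corrMatrix q) 1]; exact Matrix.PosDef.one
  have : IsEmpty (PairIdx 0) := ⟨fun e => by
    obtain ⟨e, he⟩ := e
    induction e with | _ a b => exact a.elim0⟩
  simp [detMoment, detWeight, hpd, volume_pi]

/-- Unfolding the recursion trades size for exponent: `n + m` is the same at every step, so all
numerators equal `ω_{T-1+m}`. -/
lemma detMoment_eq (T m : ℕ) :
    detMoment T m = ENNReal.ofReal
      (ballVol (T - 1 + m) ^ T / ∏ k ∈ Finset.range T, ballVol (m + k)) := by
  induction T generalizing m with
  | zero => simp [detMoment_zero]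
  | succ n ih =>
    have h := ballVol_mul_detMoment_succ n m
    have hpos := ballVol_pos m
    have h0 : ENNReal.ofReal (ballVol m) ≠ 0 := by simpa using hpos
    rw [ih, ← ENNReal.ofReal_mul (ballVol_pos _).le] at h
    rw [← ENNReal.mul_right_inj h0 ENNReal.ofReal_ne_top, h, ← ENNReal.ofReal_mul hpos.le]
    congr 1
    have hP : ∏ k ∈ Finset.range n, ballVol (m + 1 + k) ≠ 0 :=
      Finset.prod_ne_zero_iff.2 fun k _ => (ballVol_pos _).ne'
    have hP' : ∏ k ∈ Finset.range (n + 1), ballVol (m + k) =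
        ballVol m * ∏ k ∈ Finset.range n, ballVol (m + 1 + k) := by
      rw [Finset.prod_range_succ', mul_comm]
      simp only [add_zero, add_assoc, add_comm 1]
    have hn : ballVol (n - 1 + (m + 1)) ^ n = ballVol (n + m) ^ n := by
      rcases n with _ | n
      · simp
      · congr 2; omega
    rw [hP', hn, Nat.add_sub_cancel]
    field_simp
    ring

/-- The ratio `ω_{T-1}^T / (ω_0 ⋯ ω_{T-1})` of volumes `ω_k` of unit balls, which is the volume of
the set of positive definite correlation matrices of size `T`. For `T = 0` the truncated index
`T - 1` is harmless, since it occurs under the exponent `0`. -/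
noncomputable def corrVol (T : ℕ) : ℝ :=
  ballVol (T - 1) ^ T / ∏ k ∈ Finset.range T, ballVol k

lemma volume_posDef_corrMatrix (T : ℕ) :
    volume {q : PairIdx T → ℝ | (corrMatrix q).PosDef} = ENNReal.ofReal (corrVol T) := by
  classical
  have h := detMoment_eq T 0
  simp only [zero_add, add_zero] at h
  rw [corrVol, ← h, detMoment]
  have hs : MeasurableSet {q : PairIdx T → ℝ | (corrMatrix q).PosDef} := by
    have : Measurable fun q : PairIdx T → ℝ => (fun i j => corrMatrix q i j) :=
      measurable_pi_lambda _ fun i => measurable_pi_lambda _ fun j =>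
        measurable_corrMatrix_apply i j
    exact this (measurableSet_posDef (Fin T))
  rw [← lintegral_indicator_one hs]
  refine lintegral_congr fun q => ?_
  simp [detWeight, Set.indicator_apply]

/-! ### Scaling and the boundary of the region -/

lemma corrMatrix_smul {T : ℕ} (t : ℝ) (q : PairIdx T → ℝ) :
    corrMatrix (t • q) = (1 - t) • (1 : Matrix (Fin T) (Fin T) ℝ) + t • corrMatrix q := by
  ext i j
  by_cases h : i = j
  · subst h
    simp [corrMatrix_apply_self]
  · simp [corrMatrix_apply_ne _ h, h]

lemma Matrix.PosDef.exists_sub_smul_one_posSemidef {ι : Type*} [Fintype ι] [DecidableEq ι]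
    {M : Matrix ι ι ℝ} (hM : M.PosDef) :
    ∃ ε ∈ Set.Ioc (0 : ℝ) 1, (M - ε • (1 : Matrix ι ι ℝ)).PosSemidef := by
  rcases isEmpty_or_nonempty ι with hι | hι
  · refine ⟨1, by simp, ?_⟩
    rw [Subsingleton.elim (M - (1 : ℝ) • (1 : Matrix ι ι ℝ)) 0]
    exact .zero
  obtain ⟨i, hi⟩ := Finite.exists_min hM.isHermitian.eigenvalues
  -- The smallest eigenvalue, capped at `1`, is the required `ε`.
  refine ⟨min (hM.isHermitian.eigenvalues i) 1, ⟨lt_min (hM.eigenvalues_pos i) one_pos,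
    min_le_right _ _⟩, ?_⟩
  set ε := min (hM.isHermitian.eigenvalues i) 1
  rw [posSemidef_iff_isHermitian_and_spectrum_nonneg]
  refine ⟨hM.isHermitian.sub ?_, ?_⟩
  · rw [Matrix.IsHermitian, conjTranspose_smul, conjTranspose_one, star_trivial]
  · intro a ha
    have h1 : a + ε ∈ spectrum ℝ M := by
      rw [← Algebra.algebraMap_eq_smul_one] at ha
      refine spectrum.add_mem_iff.2 ?_
      rwa [neg_add_eq_sub]
    rw [hM.isHermitian.spectrum_eq_image_range] at h1
    obtain ⟨-, ⟨j, rfl⟩, hj⟩ := h1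
    have h2 := hi j
    have h3 : ε ≤ hM.isHermitian.eigenvalues i := min_le_left _ _
    simp at hj
    simp
    linarith

lemma corrRegion_one_eq (T : ℕ) :
    corrRegion T 1 = {q : PairIdx T → ℝ | (corrMatrix q).PosDef} := by
  ext q
  simp only [corrRegion, if_true, Set.mem_iUnion, corrRegionLT, Set.mem_ofPred_eq]
  constructor
  · rintro ⟨γ, hγ, h⟩
    have h1 : ((1 - γ) • (1 : Matrix (Fin T) (Fin T) ℝ)).PosDef :=
      Matrix.PosDef.one.smul (by linarith [hγ.2])
    simpa using h1.posSemidef_add h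
  · intro h
    obtain ⟨ε, hε, h⟩ := h.exists_sub_smul_one_posSemidef
    exact ⟨1 - ε, ⟨by linarith [hε.2], by linarith [hε.1]⟩, by simpa using h⟩

lemma volume_smul_corr {T : ℕ} {t : ℝ} (ht : 0 ≤ t) (s : Set (PairIdx T → ℝ)) :
    volume (t • s) = ENNReal.ofReal (t ^ T.choose 2) * volume s := by
  rw [Measure.addHaar_smul, Module.finrank_fintype_fun_eq_card, Sym2.card_subtype_not_diag,
    Fintype.card_fin, abs_of_nonneg (by positivity)]

/-- For `0 < t < 1`, contracting the semidefinite region by `t` lands in the definite one, so the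
boundary is a null set. -/
lemma volume_posSemidef_corrMatrix (T : ℕ) :
    volume {q : PairIdx T → ℝ | (corrMatrix q).PosSemidef} =
      volume {q : PairIdx T → ℝ | (corrMatrix q).PosDef} := by
  refine le_antisymm ?_ (measure_mono fun q h => Matrix.PosDef.posSemidef h)
  have hlim : Filter.Tendsto (fun t : ℝ => ENNReal.ofReal (t ^ T.choose 2) *
      volume {q : PairIdx T → ℝ | (corrMatrix q).PosSemidef}) (nhdsWithin 1 (Set.Iio 1))
      (nhds (1 * volume {q : PairIdx T → ℝ | (corrMatrix q).PosSemidef})) := by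
    refine ENNReal.Tendsto.mul_const ?_ (Or.inl one_ne_zero)
    have : Continuous fun t : ℝ => ENNReal.ofReal (t ^ T.choose 2) :=
      ENNReal.continuous_ofReal.comp (continuous_pow _)
    simpa using this.continuousWithinAt.tendsto (x := 1) (s := Set.Iio 1)
  rw [one_mul] at hlim
  refine le_of_tendsto hlim ?_
  filter_upwards [Ioo_mem_nhdsLT (zero_lt_one' ℝ)] with t ht
  rw [← volume_smul_corr ht.1.le]
  refine measure_mono ?_
  rintro - ⟨q, hq, rfl⟩
  change (corrMatrix (t • q)).PosDef
  rw [corrMatrix_smul]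
  exact (Matrix.PosDef.one.smul (by linarith [ht.2])).add_posSemidef (hq.smul ht.1.le)

lemma volume_corrRegionLT {T : ℕ} {γ : ℝ} (hγ : 0 < γ) :
    volume (corrRegionLT T γ) = ENNReal.ofReal (γ ^ T.choose 2) * volume (corrRegion T 1) := by
  rw [corrRegion_one_eq, ← volume_posSemidef_corrMatrix, ← volume_smul_corr hγ.le]
  congr 1
  ext q
  rw [Set.mem_smul_set_iff_inv_smul_mem₀ hγ.ne']
  simp only [corrRegionLT, Set.mem_ofPred_eq]
  have h : corrMatrix q - (1 - γ) • (1 : Matrix (Fin T) (Fin T) ℝ) =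
      γ • corrMatrix (γ⁻¹ • q) := by
    conv_lhs => rw [← smul_inv_smul₀ hγ.ne' q, corrMatrix_smul]
    simp
  rw [h]
  refine ⟨fun h => ?_, fun h => h.smul hγ.le⟩
  simpa [hγ.ne'] using h.smul (inv_nonneg.2 hγ.le)

lemma volume_corrRegion_one (T : ℕ) :
    volume (corrRegion T 1) = ENNReal.ofReal (corrVol T) := by
  rw [corrRegion_one_eq, volume_posDef_corrMatrix]

/-- The region with `γ = 0` lies in each region with `γ > 0`, whose volumes tend to `0`. -/
lemma volume_corrRegionLT_zero {T : ℕ} (hT : 2 ≤ T) : volume (corrRegionLT T 0) = 0 := by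
  have hc : T.choose 2 ≠ 0 := (Nat.choose_pos hT).ne'
  have hlim : Filter.Tendsto (fun t : ℝ => ENNReal.ofReal (t ^ T.choose 2) *
      volume (corrRegion T 1)) (nhdsWithin 0 (Set.Ioi 0))
      (nhds (0 * volume (corrRegion T 1))) := by
    refine ENNReal.Tendsto.mul_const ?_ (Or.inr ?_)
    · have : Continuous fun t : ℝ => ENNReal.ofReal (t ^ T.choose 2) :=
      ENNReal.continuous_ofReal.comp (continuous_pow _)
      simpa [hc] using this.continuousWithinAt.tendsto (x := 0) (s := Set.Ioi 0)
    · rw [volume_corrRegion_one]; exact ENNReal.ofReal_ne_top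
  rw [zero_mul] at hlim
  refine le_antisymm (ge_of_tendsto hlim ?_) bot_le
  filter_upwards [self_mem_nhdsWithin] with t ht
  rw [← volume_corrRegionLT ht]
  refine measure_mono fun q hq => ?_
  have h1 : (t • (1 : Matrix (Fin T) (Fin T) ℝ)).PosSemidef :=
    Matrix.PosSemidef.one.smul (le_of_lt ht)
  have h2 := Matrix.PosSemidef.add hq h1
  have h3 : corrMatrix q - (1 - (0 : ℝ)) • (1 : Matrix (Fin T) (Fin T) ℝ) + t • 1 =
      corrMatrix q - (1 - t) • 1 := by
    module
  rw [h3] at h2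
  exact h2

lemma volume_corrRegion {T : ℕ} (hT : 2 ≤ T) {γ : ℝ} (hγ : γ ∈ Set.Icc (0 : ℝ) 1) :
    volume (corrRegion T γ) = ENNReal.ofReal (γ ^ T.choose 2) * volume (corrRegion T 1) := by
  rcases eq_or_ne γ 1 with rfl | h1
  · simp
  · have : corrRegion T γ = corrRegionLT T γ := by simp [corrRegion, h1]
    rw [this]
    rcases hγ.1.eq_or_lt with rfl | h0
    · rw [volume_corrRegionLT_zero hT, zero_pow (Nat.choose_pos hT).ne', ENNReal.ofReal_zero,
        zero_mul]
    · exact volume_corrRegionLT h0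

/-! ### The closed form -/

/-- The ratio `ω_{n+1} / ω_n` of volumes of consecutive unit balls. -/
noncomputable def ballRatio (n : ℕ) : ℝ := ballVol (n + 1) / ballVol n

lemma corrVol_pos (T : ℕ) : 0 < corrVol T :=
  div_pos (pow_pos (ballVol_pos _) _) (Finset.prod_pos fun k _ => ballVol_pos k)

lemma corrVol_add_two (n : ℕ) :
    corrVol (n + 2) = corrVol (n + 1) * ballRatio n ^ (n + 1) := by
  have h1 := (ballVol_pos n).ne'
  have h2 := (ballVol_pos (n + 1)).ne'
  have h3 : ∏ k ∈ Finset.range (n + 1), ballVol k ≠ 0 :=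
    Finset.prod_ne_zero_iff.2 fun k _ => (ballVol_pos k).ne'
  rw [corrVol, corrVol, Finset.prod_range_succ _ (n + 1), show n + 2 - 1 = n + 1 by omega,
    Nat.add_sub_cancel, ballRatio, div_pow]
  field_simp
  ring

lemma ballRatio_eq (n : ℕ) :
    ballRatio n =
      √Real.pi * Real.Gamma ((n : ℝ) / 2 + 1) / Real.Gamma ((n : ℝ) / 2 + 3 / 2) := by
  have h1 := (Real.Gamma_pos_of_pos (s := (n : ℝ) / 2 + 1) (by positivity)).ne'
  have h2 := (Real.Gamma_pos_of_pos (s := (n : ℝ) / 2 + 3 / 2) (by positivity)).ne'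
  have h3 : √Real.pi ≠ 0 := (Real.sqrt_pos.2 Real.pi_pos).ne'
  have h4 : ((n + 1 : ℕ) : ℝ) / 2 + 1 = (n : ℝ) / 2 + 3 / 2 := by push_cast; ring
  rw [ballRatio, ballVol, ballVol, h4]
  field_simp
  ring

lemma Gamma_three_halves : Real.Gamma (3 / 2) = √Real.pi / 2 := by
  rw [show (3 / 2 : ℝ) = 1 / 2 + 1 by norm_num, Real.Gamma_add_one (by norm_num),
    Real.Gamma_one_half_eq]
  ring

lemma corrVol_one : corrVol 1 = 1 := by
  have := (ballVol_pos 0).ne'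
  simp [corrVol, this]

/-- The closed form, by induction: both sides are multiplied by the same power of `ω_T / ω_{T-1}`
when `T` grows by one. -/
lemma corrVol_eq (n : ℕ) :
    corrVol (n + 2) =
      (Real.pi ^ ((((n + 2).choose 2 : ℕ) + 1 : ℝ) / 2) * Real.Gamma ((n + 2 : ℕ) : ℝ) *
        ∏ j ∈ Finset.Icc 2 (n + 1), Real.Gamma ((j : ℝ) / 2)) /
        ((2 : ℝ) ^ (n + 1) * Real.Gamma ((((n + 2 : ℕ) : ℝ) + 1) / 2) ^ (n + 2)) := by
  have hpi := Real.pi_pos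
  have hs : √Real.pi ^ 2 = Real.pi := Real.sq_sqrt hpi.le
  have hs0 : √Real.pi ≠ 0 := (Real.sqrt_pos.2 hpi).ne'
  induction n with
  | zero =>
    rw [corrVol_add_two, ballRatio_eq, corrVol_one]
    norm_num [Gamma_three_halves, Real.Gamma_two, Nat.choose]
    field_simp
    rw [hs]
  | succ n ih =>
    rw [corrVol_add_two, ih, ballRatio_eq]
    have hc : (((n + 3).choose 2 : ℕ) : ℝ) = (n + 2).choose 2 + (n + 2) := by
      rw [Nat.choose_succ_succ' (n + 2) 1]; push_cast; simp; ring
    have hp : Real.pi ^ ((((n + 3).choose 2 : ℕ) + 1 : ℝ) / 2) =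
        Real.pi ^ ((((n + 2).choose 2 : ℕ) + 1 : ℝ) / 2) * √Real.pi ^ (n + 2) := by
      rw [hc, show ((((n + 2).choose 2 : ℕ) : ℝ) + (n + 2) + 1) / 2 =
        (((n + 2).choose 2 : ℕ) + 1 : ℝ) / 2 + (1 / 2) * ((n + 2 : ℕ) : ℝ) by push_cast; ring,
        Real.rpow_add hpi, Real.rpow_mul hpi.le, Real.rpow_natCast, Real.sqrt_eq_rpow]
    have hg : Real.Gamma ((n + 1 + 2 : ℕ) : ℝ) = (n + 2) * Real.Gamma ((n + 2 : ℕ) : ℝ) := by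
      rw [show ((n + 1 + 2 : ℕ) : ℝ) = ((n + 2 : ℕ) : ℝ) + 1 by push_cast; ring,
        Real.Gamma_add_one (by positivity)]
      push_cast; ring
    have hprod : ∏ j ∈ Finset.Icc 2 (n + 1 + 1), Real.Gamma ((j : ℝ) / 2) =
        (∏ j ∈ Finset.Icc 2 (n + 1), Real.Gamma ((j : ℝ) / 2)) * Real.Gamma ((n + 2) / 2 : ℝ) := by
      rw [Finset.prod_Icc_succ_top (by omega)]; push_cast; ring_nf
    have hg2 : Real.Gamma ((((n + 1 + 2 : ℕ) : ℝ) + 1) / 2) =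
        (n + 2) / 2 * Real.Gamma ((n + 2) / 2 : ℝ) := by
      rw [← Real.Gamma_add_one (by positivity)]; push_cast; ring_nf
    have e1 : ((n + 1 : ℕ) : ℝ) / 2 + 1 = (((n + 2 : ℕ) : ℝ) + 1) / 2 := by push_cast; ring
    have e2 : ((n + 1 : ℕ) : ℝ) / 2 + 3 / 2 = (((n + 1 + 2 : ℕ) : ℝ) + 1) / 2 := by
      push_cast; ring
    rw [hp, hg, hprod, e1, e2, hg2]
    have g1 := (Real.Gamma_pos_of_pos (s := ((n : ℝ) + 2) / 2) (by positivity)).ne'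
    have g2 := (Real.Gamma_pos_of_pos (s := (((n + 2 : ℕ) : ℝ) + 1) / 2) (by positivity)).ne'
    generalize Real.Gamma (((n : ℝ) + 2) / 2) = G at *
    generalize Real.Gamma ((((n + 2 : ℕ) : ℝ) + 1) / 2) = H at *
    generalize ∏ j ∈ Finset.Icc 2 (n + 1), Real.Gamma ((j : ℝ) / 2) = P
    generalize Real.Gamma ((n + 2 : ℕ) : ℝ) = Q
    have hn : (n : ℝ) + 2 ≠ 0 := by positivity
    generalize (n : ℝ) + 2 = N at *
    -- `K = Γ((n + 4) / 2)` replaces `G = Γ((n + 2) / 2)`, so that only powers of `K` occur.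
    obtain ⟨K, hK⟩ : ∃ K, K = N / 2 * G := ⟨_, rfl⟩
    have hG : G = 2 * K / N := by rw [hK]; field_simp
    have hK0 : K ≠ 0 := by rw [hK]; positivity
    rw [← hK, hG, div_pow, mul_pow √Real.pi H]
    field_simp
    ring

lemma corrVol_two : corrVol 2 = 2 := by
  have hs0 : √Real.pi ≠ 0 := (Real.sqrt_pos.2 Real.pi_pos).ne'
  rw [corrVol_add_two, ballRatio_eq, corrVol_one]
  norm_num [Gamma_three_halves]
  field_simp

lemma corrVol_three : corrVol 3 = Real.pi ^ 2 / 2 := by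
  have hs : √Real.pi ^ 2 = Real.pi := Real.sq_sqrt Real.pi_pos.le
  rw [corrVol_add_two, ballRatio_eq, corrVol_two]
  norm_num [Gamma_three_halves, Real.Gamma_two]
  rw [show √Real.pi * (√Real.pi / 2) = √Real.pi ^ 2 / 2 by ring, hs]
  ring

lemma corrVol_four : corrVol 4 = 32 / 27 * Real.pi ^ 2 := by
  have hs0 : √Real.pi ≠ 0 := (Real.sqrt_pos.2 Real.pi_pos).ne'
  have h52 : Real.Gamma (5 / 2) = 3 / 2 * (√Real.pi / 2) := by
    rw [show (5 / 2 : ℝ) = 3 / 2 + 1 by norm_num, Real.Gamma_add_one (by norm_num),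
      Gamma_three_halves]
  rw [corrVol_add_two, ballRatio_eq, corrVol_three]
  norm_num [h52, Real.Gamma_two]
  field_simp
  norm_num

/-! ### Asymptotics -/

lemma ballRatio_pos (n : ℕ) : 0 < ballRatio n := div_pos (ballVol_pos _) (ballVol_pos _)

lemma ballRatio_mul_succ (n : ℕ) : ballRatio n * ballRatio (n + 1) = 2 * Real.pi / (n + 2) := by
  have h1 := (ballVol_pos (n + 1)).ne'
  have h2 := (Real.Gamma_pos_of_pos (s := (n : ℝ) / 2 + 1) (by positivity)).ne'
  have h3 : √Real.pi ≠ 0 := (Real.sqrt_pos.2 Real.pi_pos).ne'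
  have hs : √Real.pi ^ 2 = Real.pi := Real.sq_sqrt Real.pi_pos.le
  rw [ballRatio, ballRatio, div_mul_div_cancel₀' h1, ballVol, ballVol,
    show ((n + 1 + 1 : ℕ) : ℝ) / 2 + 1 = ((n : ℝ) / 2 + 1) + 1 by push_cast; ring,
    Real.Gamma_add_one (by positivity), show n + 1 + 1 = n + 2 from rfl, pow_add, hs]
  field_simp

/-- The volumes of unit balls are log-concave in the dimension, as `Γ` is log-convex. -/
lemma ballRatio_succ_le (n : ℕ) : ballRatio (n + 1) ≤ ballRatio n := by
  have hx : (0 : ℝ) < (n : ℝ) / 2 + 1 := by positivity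
  have g1 := Real.Gamma_pos_of_pos (s := (n : ℝ) / 2 + 1) hx
  have g2 := Real.Gamma_pos_of_pos (s := (n : ℝ) / 2 + 3 / 2) (by positivity)
  have g3 := Real.Gamma_pos_of_pos (s := (n : ℝ) / 2 + 2) (by positivity)
  have h := Real.Gamma_mul_add_mul_le_rpow_Gamma_mul_rpow_Gamma hx
    (show (0 : ℝ) < (n : ℝ) / 2 + 2 by positivity) (one_half_pos (α := ℝ)) one_half_pos
    (add_halves 1)
  rw [show 1 / 2 * ((n : ℝ) / 2 + 1) + 1 / 2 * ((n : ℝ) / 2 + 2) = (n : ℝ) / 2 + 3 / 2 by ring,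
    ← Real.sqrt_eq_rpow, ← Real.sqrt_eq_rpow, ← Real.sqrt_mul g1.le] at h
  have h2 := (Real.le_sqrt g2.le (by positivity)).1 h
  rw [ballRatio_eq, ballRatio_eq,
    show ((n + 1 : ℕ) : ℝ) / 2 + 1 = (n : ℝ) / 2 + 3 / 2 by push_cast; ring,
    show ((n + 1 : ℕ) : ℝ) / 2 + 3 / 2 = (n : ℝ) / 2 + 2 by push_cast; ring,
    div_le_div_iff₀ g3 g2]
  have := Real.sqrt_nonneg Real.pi
  nlinarith [mul_le_mul_of_nonneg_left h2 this]

lemma log_ballRatio_add_succ (n : ℕ) :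
    Real.log (ballRatio n) + Real.log (ballRatio (n + 1)) =
      Real.log (2 * Real.pi) - Real.log (n + 2) := by
  rw [← Real.log_mul (ballRatio_pos _).ne' (ballRatio_pos _).ne', ballRatio_mul_succ,
    Real.log_div (by positivity) (by positivity)]

/-- The bounds on `ω_{n+1} / ω_n` come from monotonicity and the known products of consecutive
ratios, except for `n = 0` in the upper bound, where `ω_1 / ω_0 = 2` and `4 ≤ 2π`. -/
lemma log_ballRatio_le (n : ℕ) :
    Real.log (ballRatio n) ≤ (Real.log (2 * Real.pi) - Real.log (n + 1)) / 2 := by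
  rcases n with _ | n
  · have h1 : Real.log (ballRatio 0) ≤ Real.log (2 * Real.pi) / 2 := by
      have h : ballRatio 0 = 2 := by
        have hs : √Real.pi ≠ 0 := (Real.sqrt_pos.2 Real.pi_pos).ne'
        rw [ballRatio_eq]
        norm_num [Gamma_three_halves]
        field_simp
      have h2 : 2 * Real.log 2 ≤ Real.log (2 * Real.pi) := by
        rw [show 2 * Real.log 2 = Real.log (2 ^ 2) by rw [Real.log_pow]; norm_num]
        exact Real.log_le_log (by norm_num) (by linarith [Real.pi_gt_three])
      rw [h]; linarith
    simpa using h1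
  · have h1 := log_ballRatio_add_succ n
    have h2 := Real.log_le_log (ballRatio_pos _) (ballRatio_succ_le n)
    have : ((n + 1 : ℕ) : ℝ) + 1 = n + 2 := by push_cast; ring
    rw [this]
    linarith

lemma le_log_ballRatio (n : ℕ) :
    (Real.log (2 * Real.pi) - Real.log (n + 2)) / 2 ≤ Real.log (ballRatio n) := by
  have h1 := log_ballRatio_add_succ n
  have h2 := Real.log_le_log (ballRatio_pos _) (ballRatio_succ_le n)
  linarith

/-- The difference between `log Vol` in size `n + 1` and its predicted asymptotic form. -/
noncomputable def logVolError (n : ℕ) : ℝ :=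
  Real.log (corrVol (n + 1)) -
    ((n : ℝ) * (n + 1) / 4 * (Real.log (2 * Real.pi) + 1 / 2 - Real.log (n + 1)) - (n + 1) / 8)

lemma log_corrVol_succ (n : ℕ) :
    Real.log (corrVol (n + 2)) = Real.log (corrVol (n + 1)) + (n + 1) * Real.log (ballRatio n) := by
  rw [corrVol_add_two, Real.log_mul (corrVol_pos _).ne' (pow_pos (ballRatio_pos n) _).ne',
    Real.log_pow]
  push_cast; ring

lemma logVolError_succ_sub (n : ℕ) :
    logVolError (n + 1) - logVolError n =
      (n + 1) * (Real.log (ballRatio n) - (Real.log (2 * Real.pi) - Real.log (n + 1)) / 2)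
        - (n + 1) / 4 + (n + 1) * (n + 2) / 4 * (Real.log (n + 2) - Real.log (n + 1)) + 1 / 8 := by
  rw [logVolError, logVolError, log_corrVol_succ,
    show ((n + 1 : ℕ) : ℝ) + 1 = n + 2 by push_cast; ring]
  push_cast; ring

lemma abs_logVolError_succ_sub_le (n : ℕ) : |logVolError (n + 1) - logVolError n| ≤ 1 := by
  have hM : (0 : ℝ) < n + 1 := by positivity
  have hM2 : (0 : ℝ) < n + 2 := by positivity
  have hd : Real.log (n + 2) - Real.log (n + 1) = Real.log ((n + 2) / (n + 1)) :=
    (Real.log_div hM2.ne' hM.ne').symm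
  have h1 := Real.log_le_sub_one_of_pos (div_pos hM2 hM)
  have h2 := Real.one_sub_inv_le_log_of_pos (div_pos hM2 hM)
  rw [← hd] at h1 h2
  have e1 : ((n : ℝ) + 2) / (n + 1) - 1 = 1 / (n + 1) := by field_simp; ring
  have e2 : 1 - (((n : ℝ) + 2) / (n + 1))⁻¹ = 1 / (n + 2) := by field_simp; ring
  rw [e1, le_div_iff₀ hM] at h1
  rw [e2, div_le_iff₀ hM2] at h2
  have h3 := log_ballRatio_le n
  have h4 := le_log_ballRatio n
  rw [logVolError_succ_sub]
  set δ := Real.log (n + 2) - Real.log (n + 1) with hδ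
  set β := Real.log (ballRatio n) - (Real.log (2 * Real.pi) - Real.log (n + 1)) / 2 with hβ
  have h5 : β ≤ 0 := by linarith
  have h6 : -δ / 2 ≤ β := by rw [hδ]; linarith
  have h7 : (n + 1 : ℝ) * β ≤ 0 := mul_nonpos_of_nonneg_of_nonpos hM.le h5
  have h8 : -(1 / 2 : ℝ) ≤ (n + 1) * β := by nlinarith
  have h9 : (n + 1 : ℝ) * (n + 2) / 4 * δ ≤ (n + 2) / 4 := by nlinarith
  have h10 : (n + 1 : ℝ) / 4 ≤ (n + 1 : ℝ) * (n + 2) / 4 * δ := by nlinarith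
  rw [abs_le]
  constructor <;> linarith

/-- Second-order Taylor expansion of the logarithms at `1 ± 1 / N`. -/
lemma abs_log_expansion_le {N : ℝ} (hN : 2 ≤ N) :
    |N * (N + 1) / 4 * (Real.log (N + 1) - Real.log N)
      - (N - 1) * (N - 2) / 4 * (Real.log (N - 1) - Real.log N) - (N - 1) / 2| ≤ 3 / N := by
  have hN0 : 0 < N := by linarith
  have hx : |1 / N| < 1 := by
    rw [abs_of_pos (by positivity), div_lt_one hN0]; linarith
  have hx' : |-(1 / N)| < 1 := by rwa [abs_neg]
  have hb : |1 / N| ^ (2 + 1) / (1 - |1 / N|) ≤ 2 / N ^ 3 := by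
    rw [abs_of_pos (by positivity : 0 < 1 / N), div_pow, one_pow, div_div]
    have : N ^ 3 * (1 / 2) ≤ N ^ 3 * (1 - 1 / N) := by
      refine mul_le_mul_of_nonneg_left ?_ (by positivity)
      have : 1 / N ≤ 1 / 2 := one_div_le_one_div_of_le two_pos hN
      linarith
    calc 1 / (N ^ 3 * (1 - 1 / N)) ≤ 1 / (N ^ 3 * (1 / 2)) :=
          one_div_le_one_div_of_le (by positivity) this
      _ = 2 / N ^ 3 := by field_simp
  have h1 := (Real.abs_log_sub_add_sum_range_le hx 2).trans hb
  have h2 := Real.abs_log_sub_add_sum_range_le hx' 2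
  rw [abs_neg] at h2
  have h2 := h2.trans hb
  have l1 : Real.log (1 - 1 / N) = Real.log (N - 1) - Real.log N := by
    rw [← Real.log_div (by linarith) hN0.ne']; congr 1; field_simp
  have l2 : Real.log (1 - -(1 / N)) = Real.log (N + 1) - Real.log N := by
    rw [← Real.log_div (by linarith) hN0.ne']; congr 1; field_simp; ring
  rw [l1] at h1
  rw [l2] at h2
  simp only [Finset.sum_range_succ, Finset.sum_range_zero] at h1 h2
  norm_num at h1 h2
  set p := Real.log (N + 1) - Real.log N
  set r := Real.log (N - 1) - Real.log N
  obtain ⟨s, hs⟩ : ∃ s, s = N⁻¹ + (N ^ 2)⁻¹ / 2 + r := ⟨_, rfl⟩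
  obtain ⟨t, ht⟩ : ∃ t, t = -N⁻¹ + (N ^ 2)⁻¹ / 2 + p := ⟨_, rfl⟩
  rw [← hs] at h1
  rw [← ht] at h2
  have hr : r = s - (N⁻¹ + (N ^ 2)⁻¹ / 2) := by rw [hs]; ring
  have hp : p = t - (-N⁻¹ + (N ^ 2)⁻¹ / 2) := by rw [ht]; ring
  -- The terms of order `1` and `1 / N` cancel, leaving `1 / (4 N²)` and the Taylor remainders.
  have key : N * (N + 1) / 4 * p - (N - 1) * (N - 2) / 4 * r - (N - 1) / 2 =
      N * (N + 1) / 4 * t - (N - 1) * (N - 2) / 4 * s + 1 / (4 * N ^ 2) := by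
    rw [hr, hp]; field_simp; ring
  rw [key]
  have c1 : 0 ≤ N * (N + 1) / 4 := by positivity
  have c2 : 0 ≤ (N - 1) * (N - 2) / 4 :=
    div_nonneg (mul_nonneg (by linarith) (by linarith)) (by norm_num)
  calc |N * (N + 1) / 4 * t - (N - 1) * (N - 2) / 4 * s + 1 / (4 * N ^ 2)|
      ≤ |N * (N + 1) / 4 * t| + |(N - 1) * (N - 2) / 4 * s| + |1 / (4 * N ^ 2)| :=
        (abs_add_le _ _).trans (add_le_add_left (abs_sub _ _) _)
    _ ≤ N * (N + 1) / 4 * (2 / N ^ 3) + (N - 1) * (N - 2) / 4 * (2 / N ^ 3) + 1 / (4 * N ^ 2) := by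
        rw [abs_mul, abs_mul, abs_of_nonneg c1, abs_of_nonneg c2,
          abs_of_pos (by positivity : 0 < 1 / (4 * N ^ 2))]
        gcongr
    _ ≤ 3 / N := by
        rw [← sub_nonneg]
        have : 3 / N - (N * (N + 1) / 4 * (2 / N ^ 3) + (N - 1) * (N - 2) / 4 * (2 / N ^ 3)
            + 1 / (4 * N ^ 2)) = (8 * N ^ 2 + 3 * N - 4) / (4 * N ^ 3) := by
          field_simp; ring
        rw [this]
        exact div_nonneg (by nlinarith) (by positivity)

/-- Two consecutive increments cancel in the limit: the product of consecutive ball ratios is known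
exactly, so that a logarithm of a single ratio has to be estimated only without the factor `n`. -/
lemma tendsto_logVolError_two_step :
    Tendsto (fun n => logVolError (n + 2) - logVolError n) atTop (𝓝 0) := by
  have hN : Tendsto (fun n : ℕ => (n : ℝ) + 2) atTop atTop :=
    tendsto_atTop_add_const_right _ _ tendsto_natCast_atTop_atTop
  have hbound : Tendsto (fun n : ℕ => 4 / ((n : ℝ) + 2)) atTop (𝓝 0) :=
    hN.const_div_atTop 4
  refine squeeze_zero_norm (fun n => ?_) hbound
  have hN2 : (2 : ℝ) ≤ n + 2 := by linarith [Nat.cast_nonneg (α := ℝ) n]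
  have hN0 : (0 : ℝ) < n + 2 := by linarith
  have hexp := abs_log_expansion_le hN2
  have h1 := logVolError_succ_sub n
  have h2 := logVolError_succ_sub (n + 1)
  have h3 := log_ballRatio_add_succ n
  have h4 := log_ballRatio_le (n + 1)
  have h5 := le_log_ballRatio (n + 1)
  rw [show ((n + 1 : ℕ) : ℝ) + 1 = (n : ℝ) + 2 by push_cast; ring,
    show ((n + 1 : ℕ) : ℝ) + 2 = (n : ℝ) + 2 + 1 by push_cast; ring] at h2
  rw [show ((n + 1 : ℕ) : ℝ) + 1 = (n : ℝ) + 2 by push_cast; ring] at h4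
  rw [show ((n + 1 : ℕ) : ℝ) + 2 = (n : ℝ) + 2 + 1 by push_cast; ring] at h5
  rw [show (n : ℝ) + 1 = n + 2 - 1 by ring] at h1
  have hlog : Real.log ((n : ℝ) + 2 + 1) - Real.log (n + 2) ≤ 1 / (n + 2) := by
    have := Real.log_le_sub_one_of_pos (show (0 : ℝ) < (n + 2 + 1) / (n + 2) by positivity)
    rw [Real.log_div (by positivity) hN0.ne'] at this
    refine this.trans_eq ?_
    field_simp; ring
  set β := Real.log (ballRatio (n + 1)) - (Real.log (2 * Real.pi) - Real.log (n + 2)) / 2 with hβ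
  have hβ1 : |β| ≤ 1 / (n + 2) := by
    rw [abs_le]
    have : 0 < 1 / ((n : ℝ) + 2) := by positivity
    constructor <;> rw [hβ] <;> linarith
  have h3' : Real.log (ballRatio n) =
      Real.log (2 * Real.pi) - Real.log (n + 2) - Real.log (ballRatio (n + 1)) := by linarith
  have key : logVolError (n + 2) - logVolError n = β +
      (((n : ℝ) + 2) * (n + 2 + 1) / 4 * (Real.log (n + 2 + 1) - Real.log (n + 2))
      - (n + 2 - 1) * (n + 2 - 2) / 4 * (Real.log (n + 2 - 1) - Real.log (n + 2))
      - (n + 2 - 1) / 2) := by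
    have : logVolError (n + 2) - logVolError n =
      (logVolError (n + 1 + 1) - logVolError (n + 1)) + (logVolError (n + 1) - logVolError n) := by
      ring
    rw [this, h1, h2, h3', hβ]
    ring
  rw [key, Real.norm_eq_abs]
  calc _ ≤ _ := abs_add_le _ _
    _ ≤ 1 / ((n : ℝ) + 2) + 3 / (n + 2) := add_le_add hβ1 hexp
    _ = 4 / (n + 2) := by ring

/-- Bounded increments whose sums over two consecutive steps vanish in the limit force sublinear
growth. -/
lemma tendsto_div_of_two_step {a : ℕ → ℝ} {C : ℝ} (hb : ∀ n, |a (n + 1) - a n| ≤ C)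
    (h : Tendsto (fun n => a (n + 2) - a n) atTop (𝓝 0)) :
    Tendsto (fun n : ℕ => a n / n) atTop (𝓝 0) := by
  have h1 := h.cesaro
  have hsum : ∀ n : ℕ, ∑ i ∈ Finset.range n, (a (i + 2) - a i) =
      (a (n + 1) + a n) - (a 1 + a 0) := by
    intro n
    rw [← Finset.sum_range_sub (fun n => a (n + 1) + a n)]
    exact Finset.sum_congr rfl fun i _ => by ring
  simp only [hsum] at h1
  have hz : ∀ c : ℝ, Tendsto (fun n : ℕ => c / (n : ℝ)) atTop (𝓝 0) := fun c =>
    tendsto_const_div_atTop_nhds_zero_nat c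
  have h2 : Tendsto (fun n : ℕ => (a (n + 1) - a n) / n) atTop (𝓝 0) := by
    refine squeeze_zero_norm (fun n => ?_) (hz C)
    rw [norm_div, Real.norm_eq_abs, Real.norm_natCast]
    exact div_le_div_of_nonneg_right (hb n) (Nat.cast_nonneg n)
  have h3 := ((h1.add (hz (a 1 + a 0))).sub h2).div_const 2
  simp only [add_zero, sub_zero, zero_div] at h3
  refine h3.congr fun n => ?_
  ring

lemma tendsto_logb_corrVol :
    Tendsto (fun T : ℕ => (1 / (T : ℝ)) * Real.logb 2 (corrVol T) -
      (((T : ℝ) - 1) / 4 * Real.logb 2 (2 * Real.pi * Real.sqrt (Real.exp 1) / (T : ℝ)) -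
        Real.logb 2 (Real.exp 1) / 8)) atTop (𝓝 0) := by
  rw [← tendsto_add_atTop_iff_nat 1]
  have h1 := tendsto_div_of_two_step abs_logVolError_succ_sub_le tendsto_logVolError_two_step
  have h2 : Tendsto (fun n : ℕ => (n : ℝ) / (n + 1)) atTop (𝓝 1) :=
    tendsto_natCast_div_add_atTop 1
  have h3 := (h1.mul h2).div_const (Real.log 2)
  rw [zero_mul, zero_div] at h3
  refine h3.congr' ?_
  filter_upwards [eventually_gt_atTop 0] with n hn
  have hn0 : (n : ℝ) ≠ 0 := by positivity
  have hn1 : (n : ℝ) + 1 ≠ 0 := by positivity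
  have hl2 : Real.log 2 ≠ 0 := (Real.log_pos one_lt_two).ne'
  have hpi : 2 * Real.pi ≠ 0 := by positivity
  have hexp : √(Real.exp 1) ≠ 0 := (Real.sqrt_pos.2 (Real.exp_pos 1)).ne'
  have hlog : Real.log (2 * Real.pi * √(Real.exp 1) / ((n + 1 : ℕ) : ℝ)) =
      Real.log (2 * Real.pi) + 1 / 2 - Real.log (n + 1) := by
    rw [Real.log_div (mul_ne_zero hpi hexp) (by positivity), Real.log_mul hpi hexp,
      Real.log_sqrt (Real.exp_pos 1).le, Real.log_exp]
    push_cast; ring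
  simp only [Real.logb, hlog, Real.log_exp, logVolError]
  push_cast
  field_simp
  ring

theorem mainTheorem11 :
    (∀ T : ℕ, 2 ≤ T →
      MeasureTheory.volume (corrRegion T 1) =
        ENNReal.ofReal
          ((Real.pi ^ (((T.choose 2 : ℝ) + 1) / 2) * Real.Gamma (T : ℝ) *
              ∏ j ∈ Finset.Icc 2 (T - 1), Real.Gamma ((j : ℝ) / 2)) /
            ((2 : ℝ) ^ (T - 1) * Real.Gamma (((T : ℝ) + 1) / 2) ^ T))) ∧
    (∀ T : ℕ, 2 ≤ T → ∀ γ ∈ Set.Icc (0 : ℝ) 1,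
      MeasureTheory.volume (corrRegion T γ) =
        ENNReal.ofReal (γ ^ T.choose 2) * MeasureTheory.volume (corrRegion T 1)) ∧
    MeasureTheory.volume (corrRegion 2 1) = 2 ∧
    MeasureTheory.volume (corrRegion 3 1) = ENNReal.ofReal (Real.pi ^ 2 / 2) ∧
    MeasureTheory.volume (corrRegion 4 1) = ENNReal.ofReal (32 / 27 * Real.pi ^ 2) ∧
    Filter.Tendsto
      (fun T : ℕ =>
        (1 / (T : ℝ)) * Real.logb 2 (MeasureTheory.volume (corrRegion T 1)).toReal -
          (((T : ℝ) - 1) / 4 *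
              Real.logb 2 (2 * Real.pi * Real.sqrt (Real.exp 1) / (T : ℝ)) -
            Real.logb 2 (Real.exp 1) / 8))
      Filter.atTop (nhds 0) := by
  refine ⟨fun T hT => ?_, fun T hT γ hγ => volume_corrRegion hT hγ, ?_, ?_, ?_, ?_⟩
  · obtain ⟨n, rfl⟩ := Nat.exists_eq_add_of_le' hT
    rw [volume_corrRegion_one, corrVol_eq, show n + 2 - 1 = n + 1 by omega]
  · rw [volume_corrRegion_one, corrVol_two]; simp
  · rw [volume_corrRegion_one, corrVol_three]
  · rw [volume_corrRegion_one, corrVol_four]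
  · simp only [volume_corrRegion_one, ENNReal.toReal_ofReal (corrVol_pos _).le]
    exact tendsto_logb_corrVol
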